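/- Let $(\Omega,\mathcal A,\mathbb P)$ be an atomless probability space, i.e. every $A\in\mathcal A$ with $\mathbb P(A)>0$ contains some $B\in\mathcal A$ with $0<\mathbb P(B)<\mathbb P(A)$. Let $d$ be a natural number, and let $L^2(\Omega,\mathbb P;\mathbb R^d)$ be the Hilbert space of (a.s. classes of) square-integrable $\mathbb R^d$-valued random variables, where $\mathbb R^d$ carries the Euclidean norm. Let $F:L^2(\Omega,\mathbb P;\mathbb R^d)\to\mathbb R$ be law invariant, i.e. $F(X)=F(Y)$ whenever $X$ and $Y$ have the same law. When $F$ is Fréchet differentiable at $X$, let $DF(X)\in L^2(\Omega,\mathbb P;\mathbb R^d)$ denote its Fréchet derivative, identified through the Riesz representation theorem: $F(X+Y)=F(X)+\mathbb E[DF(X)\cdot Y]+o(\|Y\|_2)$ as $\|Y\|_2\to0$. Suppose that $F$ is Fréchet differentiable at some $X\in L^2(\Omega,\mathbb P;\mathbb R^d)$, and let $\mu$ be the law of $X$. Then there is a measurable function $g:\mathbb R^d\to\mathbb R^d$ with $g\in L^2(\mathbb R^d,\mu;\mathbb R^d)$ such that $DF(X)=g(X)$ almost surely and, for every $\tilde X\in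 L^2(\Omega,\mathbb P;\mathbb R^d)$ with law $\mu$, $F$ is Fréchet differentiable at $\tilde X$ with $DF(\tilde X)=g(\tilde X)$ almost surely. -/

import Mathlib

open MeasureTheory ProbabilityTheory
open scoped ENNReal Gradient

/-- A measure is atomless if every measurable set of positive measure contains a measurable
subset of strictly smaller positive measure. (This is stronger than the vanishing of the measure
on singletons.) -/
def IsAtomless {Ω : Type*} [MeasurableSpace Ω] (P : Measure Ω) : Prop :=
  ∀ s : Set Ω, MeasurableSet s → 0 < P s →
    ∃ t : Set Ω, t ⊆ s ∧ MeasurableSet t ∧ 0 < P t ∧ P t < P s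

/-- A function on the square-integrable `ℝ^d`-valued random variables is law invariant if its
value at `X` depends only on the law of `X`. -/
def LawInvariant {Ω : Type*} [MeasurableSpace Ω] {P : Measure Ω} {d : ℕ}
    (F : Lp (EuclideanSpace ℝ (Fin d)) 2 P → ℝ) : Prop :=
  ∀ X Y : Lp (EuclideanSpace ℝ (Fin d)) 2 P, IdentDistrib X Y P P → F X = F Y

/-! Law invariance makes $F(X+tY)$ a function of the joint law of $(X,Y)$, so a pair may be replaced
by any copy of it before expanding $F$ at $X$. A copy keeping $X$ itself need not exist, since $X$
may exhaust the randomness of $\Omega$. Fixing only the cell of $X$ in a countable partition into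
small cells leaves room: each cell of positive mass is again an atomless space, so it carries
variables of every law.

Measurability (`LawInvariant.exists_norm_sub_sq_le`): let $G=DF(X)$, and let $H$ be the conditional
expectation of $G$ given the cell of $X$. `IsAtomless.exists_resample` gives a copy $(X_1,Y_1)$ of
$(X,G)$ with $X_1$ near $X$ and $Y_1$ independent of a discretized $G$ given that cell. Expanding
$F(X+tG)=F(X_1+tY_1)$ at $X$ on both sides gives $\|G\|^2\approx\langle G,Y_1\rangle\approx\langle
G,H\rangle=\|H\|^2$, so $\|G-H\|$ is small. The functions of $X$ form a closed subspace, hence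
$G=g(X)$.

Transfer (`LawInvariant.hasGradientAt_of_identDistrib`): for $X'$ with the law of $X$ and a
perturbation $Y'$, take a copy $(X_1,Y_1)$ of $(X',Y')$ with $\|X_1-X\|\ll\|Y'\|$. The expansion of
$F(X_1+Y_1)$ at $X$ has main term $\langle g(X),Y_1\rangle\approx\langle g(X_1),Y_1\rangle=\langle
g(X'),Y'\rangle$. -/

/-! ### Atomless measures and the random variables they carry -/

namespace IsAtomless

variable {Ω : Type*} [MeasurableSpace Ω] {P : Measure Ω}

theorem restrict (hP : IsAtomless P) {s : Set Ω} (hs : MeasurableSet s) :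
    IsAtomless (P.restrict s) := by
  intro a ha ha0
  rw [Measure.restrict_apply ha] at ha0
  obtain ⟨t, hts, ht, ht0, htlt⟩ := hP (a ∩ s) (ha.inter hs) ha0
  refine ⟨t, hts.trans Set.inter_subset_left, ht, ?_, ?_⟩ <;>
    rw [Measure.restrict_apply ht, Set.inter_eq_left.2 (hts.trans Set.inter_subset_right)]
  · exact ht0
  · rwa [Measure.restrict_apply ha]

theorem smul (hP : IsAtomless P) {c : ℝ≥0∞} (hc0 : c ≠ 0) (hc : c ≠ ∞) :
    IsAtomless (c • P) := by
  intro a ha ha0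
  simp only [Measure.smul_apply, smul_eq_mul, pos_iff_ne_zero, mul_ne_zero_iff] at ha0
  obtain ⟨t, hts, ht, ht0, htlt⟩ := hP a ha (pos_iff_ne_zero.2 ha0.2)
  refine ⟨t, hts, ht, ?_, ?_⟩
  · simpa [pos_iff_ne_zero, hc0] using ht0.ne'
  · simpa using (ENNReal.mul_lt_mul_iff_right hc0 hc).2 htlt

theorem cond [IsFiniteMeasure P] (hP : IsAtomless P) {s : Set Ω} (hs : MeasurableSet s)
    (hs0 : P s ≠ 0) : IsAtomless P[|s] :=
  (hP.restrict hs).smul (ENNReal.inv_ne_zero.2 (measure_ne_top P s)) (ENNReal.inv_ne_top.2 hs0)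

/-- Sets of positive measure have measurable subsets of arbitrarily small positive measure. -/
theorem exists_subset_lt [IsFiniteMeasure P] (hP : IsAtomless P) {s : Set Ω}
    (hs : MeasurableSet s) (hs0 : 0 < P s) {ε : ℝ≥0∞} (hε : 0 < ε) :
    ∃ t ⊆ s, MeasurableSet t ∧ 0 < P t ∧ P t < ε := by
  have halve : ∀ n : ℕ, ∃ t ⊆ s, MeasurableSet t ∧ 0 < P t ∧ P t ≤ P s * 2⁻¹ ^ n := by
    intro n
    induction n with
    | zero => exact ⟨s, subset_rfl, hs, hs0, by simp⟩
    | succ n ih =>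
      obtain ⟨t, hts, ht, ht0, htn⟩ := ih
      obtain ⟨u, hut, hu, hu0, hult⟩ := hP t ht ht0
      have hadd : P u + P (t \ u) = P t := by
        rw [← measure_inter_add_sdiff t hu, Set.inter_eq_right.2 hut]
      -- The lighter of the two pieces of `t` has at most half its mass.
      have key : ∀ x y : ℝ≥0∞, x ≤ y → x + y = P t → x ≤ P s * 2⁻¹ ^ (n + 1) := by
        intro x y hxy h
        have h2 : x * 2 ≤ P t := by rw [mul_two, ← h]; gcongr
        calc x = x * 2 * 2⁻¹ := by
              rw [mul_assoc, ENNReal.mul_inv_cancel (by simp) (by simp), mul_one]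
          _ ≤ P s * 2⁻¹ ^ n * 2⁻¹ := by gcongr ?_ * 2⁻¹; exact h2.trans htn
          _ = _ := by rw [pow_succ, mul_assoc]
      rcases le_total (P u) (P (t \ u)) with h | h
      · exact ⟨u, hut.trans hts, hu, hu0, key _ _ h hadd⟩
      · refine ⟨t \ u, Set.sdiff_subset.trans hts, ht.diff hu, ?_,
          key _ _ h (by rw [add_comm, hadd])⟩
        rw [pos_iff_ne_zero]
        intro h0
        rw [h0, add_zero] at hadd
        exact hult.ne hadd
  have hlim : Filter.Tendsto (fun n : ℕ => P s * 2⁻¹ ^ n) Filter.atTop (nhds 0) := by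
    have := ENNReal.Tendsto.const_mul (a := P s)
      (ENNReal.tendsto_pow_atTop_nhds_zero_of_lt_one (r := 2⁻¹) (by simp))
      (Or.inr (measure_ne_top P s))
    simpa using this
  obtain ⟨n, hn⟩ := (hlim.eventually_lt_const hε).exists
  obtain ⟨t, hts, ht, ht0, htn⟩ := halve n
  exact ⟨t, hts, ht, ht0, htn.trans_lt hn⟩

/-- **Sierpiński's theorem**: an atomless finite measure takes all intermediate values. -/
theorem exists_subset_measure_eq [IsFiniteMeasure P] (hP : IsAtomless P) {s : Set Ω}
    (hs : MeasurableSet s) {a : ℝ≥0∞} (ha : a ≤ P s) :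
    ∃ t ⊆ s, MeasurableSet t ∧ P t = a := by
  -- Greedy exhaustion: `C b` holds the sets that can be added to `b` without exceeding mass `a`,
  -- and each step adds one of at least half the supremal mass `m b`. If the union fell short of
  -- `a`, a small set `v` of positive mass would stay admissible forever, whereas the masses of the
  -- disjoint additions are summable and tend to 0.
  let C : Set Ω → Set (Set Ω) := fun b => {u | u ⊆ s \ b ∧ MeasurableSet u ∧ P b + P u ≤ a}
  let m : Set Ω → ℝ≥0∞ := fun b => ⨆ u ∈ C b, P u
  have step : ∀ b, P b ≤ a → ∃ u ∈ C b, m b ≤ 2 * P u := by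
    intro b hb
    rcases eq_or_ne (m b) 0 with h0 | h0
    · exact ⟨∅, ⟨Set.empty_subset _, .empty, by simpa using hb⟩, by simp [h0]⟩
    · have hfin : m b ≠ ∞ :=
        ne_top_of_le_ne_top (measure_ne_top P Set.univ)
          (iSup₂_le fun u _ => measure_mono (Set.subset_univ u))
      have : m b / 2 < m b := ENNReal.half_lt_self h0 hfin
      obtain ⟨u, hu⟩ := lt_iSup_iff.1 this
      obtain ⟨huC, hu⟩ := lt_iSup_iff.1 hu
      refine ⟨u, huC, ?_⟩
      rw [mul_comm]
      exact (ENNReal.div_le_iff (by simp) (by simp)).1 hu.le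
  choose! D hD hDm using step
  let B : ℕ → Set Ω := fun n => Nat.rec ∅ (fun _ b => b ∪ D b) n
  have hBs : ∀ n, B (n + 1) = B n ∪ D (B n) := fun n => rfl
  have hB : ∀ n, B n ⊆ s ∧ MeasurableSet (B n) ∧ P (B n) ≤ a := by
    intro n
    induction n with
    | zero => exact ⟨Set.empty_subset _, .empty, by simp [B]⟩
    | succ n ih =>
      obtain ⟨h1, h2, h3⟩ := hD (B n) ih.2.2
      rw [hBs]
      exact ⟨Set.union_subset ih.1 (h1.trans Set.sdiff_subset), ih.2.1.union h2,
        (measure_union_le _ _).trans h3⟩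
  have hmono : Monotone B := monotone_nat_of_le_succ fun n => by
    rw [hBs]; exact Set.subset_union_left
  let T := ⋃ n, B n
  have hT : MeasurableSet T := .iUnion fun n => (hB n).2.1
  have hTs : T ⊆ s := Set.iUnion_subset fun n => (hB n).1
  have hTa : P T ≤ a := by
    rw [hmono.measure_iUnion]
    exact iSup_le fun n => (hB n).2.2
  refine ⟨T, hTs, hT, hTa.antisymm ?_⟩
  by_contra! hlt
  have hdiff : 0 < P (s \ T) := by
    rw [pos_iff_ne_zero]
    intro h0
    have := measure_inter_add_sdiff (μ := P) s hT
    rw [h0, add_zero, Set.inter_eq_right.2 hTs] at this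
    exact (hlt.trans_le ha).ne this
  obtain ⟨v, hv, hvm, hv0, hvlt⟩ := hP.exists_subset_lt (hs.diff hT) hdiff (tsub_pos_of_lt hlt)
  have hvC : ∀ n, v ∈ C (B n) := fun n =>
    ⟨hv.trans (Set.sdiff_subset_sdiff_right (Set.subset_iUnion B n)), hvm, by
      calc P (B n) + P v ≤ P T + (a - P T) := by
            gcongr; exact Set.subset_iUnion B n
        _ = a := add_tsub_cancel_of_le hTa⟩
  have hvD : ∀ n, P v ≤ 2 * P (D (B n)) := fun n =>
    (le_iSup₂ (f := fun u (_ : u ∈ C (B n)) => P u) v (hvC n)).trans (hDm _ (hB n).2.2)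
  have hdisj : Pairwise (Function.onFun Disjoint fun n => D (B n)) := by
    rw [pairwise_disjoint_on]
    intro i j hij
    have h1 : D (B i) ⊆ B j :=
      (Set.subset_union_right.trans (hBs i).ge).trans (hmono (Nat.succ_le_of_lt hij))
    have h2 := (hD (B j) (hB j).2.2).1
    exact Set.disjoint_left.2 fun x hx hx' => (h2 hx').2 (h1 hx)
  have hsum : ∑' n, P (D (B n)) ≠ ∞ := by
    rw [← measure_iUnion hdisj fun n => (hD _ (hB n).2.2).2.1]
    exact measure_ne_top _ _
  have h0 := ENNReal.tendsto_atTop_zero_of_tsum_ne_top hsum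
  have h0' := ENNReal.Tendsto.const_mul (a := 2) h0 (Or.inr (by simp))
  rw [mul_zero] at h0'
  exact hv0.not_ge (ge_of_tendsto' h0' hvD)

/-- An atomless probability space splits into `2 ^ n` cells of equal probability, each stage
refining the previous one. -/
theorem exists_dyadic_splitting [IsProbabilityMeasure P] (hP : IsAtomless P) :
    ∃ k : ℕ → Ω → ℕ, (∀ n, Measurable (k n)) ∧
      (∀ n ω, 2 * k n ω ≤ k (n + 1) ω ∧ k (n + 1) ω ≤ 2 * k n ω + 1) ∧
      (∀ n ω, k n ω < 2 ^ n) ∧ ∀ n, ∀ i < 2 ^ n, P.real (k n ⁻¹' {i}) = 2⁻¹ ^ n := by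
  classical
  have half : ∀ s, MeasurableSet s → ∃ t ⊆ s, MeasurableSet t ∧ P t = P s / 2 := fun s hs =>
    hP.exists_subset_measure_eq hs ENNReal.half_le_self
  choose! h hsub hmeas hmass using half
  -- `k n ω` is the label of the stage-`n` cell of `ω`. The chosen half of cell `i` becomes cell `2
  -- * i`, the rest cell `2 * i + 1`, so labels accumulate binary digits.
  let k : ℕ → Ω → ℕ := fun n => Nat.rec (fun _ => 0)
    (fun _ f ω => if ω ∈ h (f ⁻¹' {f ω}) then 2 * f ω else 2 * f ω + 1) n
  have hk : ∀ n ω, k (n + 1) ω =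
      if ω ∈ h (k n ⁻¹' {k n ω}) then 2 * k n ω else 2 * k n ω + 1 := fun n ω => rfl
  have heven : ∀ n, Measurable (k n) → ∀ i,
      k (n + 1) ⁻¹' {2 * i} = h (k n ⁻¹' {i}) := by
    intro n hn i
    have hi := hsub _ (hn (measurableSet_singleton i))
    ext ω
    simp only [Set.mem_preimage, Set.mem_singleton_iff, hk]
    constructor
    · intro hω
      split_ifs at hω with hc
      · rwa [show k n ω = i by omega] at hc
      · omega
    · intro hω
      have : k n ω = i := hi hω
      rw [if_pos (by rwa [this]), this]
  have hodd : ∀ n, Measurable (k n) → ∀ i,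
      k (n + 1) ⁻¹' {2 * i + 1} = k n ⁻¹' {i} \ h (k n ⁻¹' {i}) := by
    intro n hn i
    ext ω
    simp only [Set.mem_preimage, Set.mem_singleton_iff, hk, Set.mem_sdiff]
    constructor
    · intro hω
      split_ifs at hω with hc
      · omega
      · have hi : k n ω = i := by omega
        rw [hi] at hc
        exact ⟨hi, hc⟩
    · rintro ⟨hi, hc⟩
      rw [if_neg (by rwa [hi]), hi]
  have hkm : ∀ n, Measurable (k n) := by
    intro n
    induction n with
    | zero => exact measurable_const
    | succ n ih =>
      refine measurable_to_countable' fun j => ?_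
      have hcell := fun i => ih (measurableSet_singleton i)
      obtain ⟨i, rfl | rfl⟩ := Nat.even_or_odd' j
      · rw [heven n ih]
        exact hmeas _ (hcell i)
      · rw [hodd n ih]
        exact (hcell i).diff (hmeas _ (hcell i))
  have hstep : ∀ n ω, 2 * k n ω ≤ k (n + 1) ω ∧ k (n + 1) ω ≤ 2 * k n ω + 1 := by
    intro n ω
    rw [hk]
    split_ifs <;> omega
  refine ⟨k, hkm, hstep, ?_, ?_⟩
  · intro n ω
    induction n with
    | zero => exact Nat.one_pos
    | succ n ih =>
      have := (hstep n ω).2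
      rw [pow_succ]
      omega
  · intro n
    induction n with
    | zero =>
      intro i hi
      have : k 0 ⁻¹' {i} = Set.univ := by
        ext ω
        have : i = 0 := by simpa using hi
        simp [k, this]
      simp [this]
    | succ n ih =>
      intro j hj
      have hhalf : ∀ i, P.real (h (k n ⁻¹' {i})) = P.real (k n ⁻¹' {i}) / 2 := fun i => by
        rw [measureReal_def, hmass _ (hkm n (measurableSet_singleton i)), ENNReal.toReal_div]
        rfl
      obtain ⟨i, rfl | rfl⟩ := Nat.even_or_odd' j
      · rw [heven n (hkm n), hhalf, ih i (by rw [pow_succ] at hj; omega), pow_succ]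
        rfl
      · have hcell := hkm n (measurableSet_singleton i)
        rw [hodd n (hkm n), measureReal_sdiff (hsub _ hcell) (hmeas _ hcell), hhalf,
          ih i (by rw [pow_succ] at hj; omega), pow_succ]
        ring

/-- An atomless probability space carries a uniformly distributed random variable. -/
theorem exists_uniform [IsProbabilityMeasure P] (hP : IsAtomless P) :
    ∃ U : Ω → unitInterval, Measurable U ∧ P.map U = volume := by
  obtain ⟨k, hkm, hstep, hlt, hmass⟩ := hP.exists_dyadic_splitting
  -- The truncation to `n` binary digits of the uniform variable `V` defined below; `V` lies between
  -- `u n` and `u n + 2⁻¹ ^ n`.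
  let u : ℕ → Ω → ℝ := fun n ω => k n ω * 2⁻¹ ^ n
  have hu1 : ∀ n ω, u n ω ≤ 1 := by
    intro n ω
    have : (k n ω : ℝ) ≤ 2 ^ n := by exact_mod_cast (hlt n ω).le
    calc u n ω ≤ 2 ^ n * 2⁻¹ ^ n := by simp only [u]; gcongr
      _ = 1 := by rw [← mul_pow]; simp
  have hbdd : ∀ ω, BddAbove (Set.range fun n => u n ω) := fun ω =>
    ⟨1, Set.forall_mem_range.2 fun n => hu1 n ω⟩
  have hmono : ∀ ω, Monotone fun n => u n ω := fun ω => monotone_nat_of_le_succ fun n => by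
    have : (2 * k n ω : ℝ) ≤ k (n + 1) ω := by exact_mod_cast (hstep n ω).1
    simp only [u, pow_succ]
    nlinarith [pow_pos (show (0 : ℝ) < 2⁻¹ by norm_num) n]
  have hanti : ∀ ω, Antitone fun n => u n ω + 2⁻¹ ^ n := fun ω => antitone_nat_of_succ_le fun n => by
    have : (k (n + 1) ω : ℝ) ≤ 2 * k n ω + 1 := by exact_mod_cast (hstep n ω).2
    simp only [u, pow_succ]
    nlinarith [pow_pos (show (0 : ℝ) < 2⁻¹ by norm_num) n]
  let V : Ω → ℝ := fun ω => ⨆ n, u n ω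
  have hle : ∀ n ω, u n ω ≤ V ω := fun n ω => le_ciSup (hbdd ω) n
  have hge : ∀ n ω, V ω ≤ u n ω + 2⁻¹ ^ n := fun n ω => ciSup_le fun m => by
    rcases le_total m n with h | h
    · exact (hmono ω h).trans (le_add_of_nonneg_right (by positivity))
    · exact (le_add_of_nonneg_right (by positivity)).trans (hanti ω h)
  have hV : Measurable V := by
    refine Measurable.iSup fun n => ?_
    exact (measurable_from_top.comp (hkm n)).mul_const _
  have hV01 : ∀ ω, V ω ∈ Set.Icc (0 : ℝ) 1 := fun ω =>
    ⟨(by simp only [u]; positivity : 0 ≤ u 0 ω).trans (hle 0 ω), ciSup_le fun n => hu1 n ω⟩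
  have hmassIio : ∀ n, ∀ j ≤ 2 ^ n, P.real (k n ⁻¹' Set.Iio j) = j * 2⁻¹ ^ n := by
    intro n j
    induction j with
    | zero => simp
    | succ j ih =>
      intro hj
      have : k n ⁻¹' Set.Iio (j + 1) = k n ⁻¹' Set.Iio j ∪ k n ⁻¹' {j} := by
        ext ω; simp only [Set.mem_preimage, Set.mem_Iio, Set.mem_union, Set.mem_singleton_iff]
        omega
      rw [this, measureReal_union _ (hkm n (measurableSet_singleton j)), ih (by omega),
        hmass n j (by omega)]
      · push_cast; ring
      · exact Set.disjoint_left.2 fun ω h1 h2 => (ne_of_lt h1) h2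
  have hlim : Filter.Tendsto (fun n : ℕ => (2⁻¹ : ℝ) ^ n) Filter.atTop (nhds 0) :=
    tendsto_pow_atTop_nhds_zero_of_lt_one (by norm_num) (by norm_num)
  have hcdf : ∀ x ∈ Set.Icc (0 : ℝ) 1, P.real (V ⁻¹' Set.Iic x) = x := by
    rintro x ⟨hx0, hx1⟩
    have hbounds : ∀ n : ℕ, P.real (V ⁻¹' Set.Iic x) ≤ x + 2⁻¹ ^ n ∧
        x - 2⁻¹ ^ n ≤ P.real (V ⁻¹' Set.Iic x) := by
      intro n
      have hp : (0 : ℝ) < 2⁻¹ ^ n := by positivity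
      have hpp : (2 : ℝ) ^ n * 2⁻¹ ^ n = 1 := by rw [← mul_pow]; simp
      have hp2 : (0 : ℝ) < 2 ^ n := by positivity
      set j := ⌊2 ^ n * x⌋₊ with hj
      have hjle : (j : ℝ) ≤ 2 ^ n * x := Nat.floor_le (by positivity)
      have hjlt : 2 ^ n * x < j + 1 := Nat.lt_floor_add_one _
      have hj2 : j ≤ 2 ^ n := by
        have : (j : ℝ) ≤ 2 ^ n := hjle.trans (by nlinarith)
        exact_mod_cast this
      constructor
      · rcases hj2.eq_or_lt with h | h
        · have hx : x = 1 := by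
            rw [h] at hjle
            push_cast at hjle
            nlinarith
          exact measureReal_le_one.trans (by linarith)
        · calc P.real (V ⁻¹' Set.Iic x) ≤ P.real (k n ⁻¹' Set.Iio (j + 1)) := by
                refine measureReal_mono fun ω hω => ?_
                have h1 : u n ω ≤ x := (hle n ω).trans hω
                have h2 : (k n ω : ℝ) ≤ 2 ^ n * x := by
                  calc (k n ω : ℝ) = 2 ^ n * u n ω := by
                        simp only [u]; rw [mul_left_comm, hpp, mul_one]
                    _ ≤ _ := by gcongr
                exact Nat.lt_succ_of_le (Nat.le_floor h2)
            _ = (j + 1 : ℕ) * 2⁻¹ ^ n := hmassIio n _ h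
            _ ≤ x + 2⁻¹ ^ n := by push_cast; nlinarith
      · calc x - 2⁻¹ ^ n ≤ j * 2⁻¹ ^ n := by nlinarith
          _ = P.real (k n ⁻¹' Set.Iio j) := (hmassIio n j hj2).symm
          _ ≤ _ := by
            refine measureReal_mono fun ω hω => (hge n ω).trans ?_
            have h1 : (k n ω : ℝ) + 1 ≤ j := by exact_mod_cast Nat.succ_le_of_lt hω
            simp only [u]
            nlinarith
    refine le_antisymm (ge_of_tendsto' (by simpa using hlim.const_add x) fun n => (hbounds n).1)
      (le_of_tendsto' (by simpa using hlim.const_sub x) fun n => (hbounds n).2)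
  refine ⟨fun ω => ⟨V ω, hV01 ω⟩, hV.subtype_mk, ?_⟩
  have := Measure.isProbabilityMeasure_map (μ := P) (hV.subtype_mk (h := hV01)).aemeasurable
  refine Measure.ext_of_Iic _ _ fun x => ?_
  rw [Measure.map_apply hV.subtype_mk measurableSet_Iic, unitInterval.volume_Iic,
    ← hcdf x x.2, ofReal_measureReal]
  rfl

/-- An atomless probability space carries random variables of every law on a standard Borel
space. -/
theorem exists_map_eq [IsProbabilityMeasure P] (hP : IsAtomless P) {E : Type*}
    [MeasurableSpace E] [StandardBorelSpace E] (ν : Measure E) [IsProbabilityMeasure ν] :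
    ∃ Z : Ω → E, Measurable Z ∧ P.map Z = ν := by
  have : Nonempty E := nonempty_of_isProbabilityMeasure ν
  obtain ⟨f, hf, hfν⟩ := ν.exists_measurable_map_eq
  obtain ⟨U, hU, hUν⟩ := hP.exists_uniform
  exact ⟨f ∘ U, hf.comp hU, by rw [← Measure.map_map hf hU, hUν, hfν]⟩

/-- Given a discrete random variable `c` on an atomless probability space, every joint law with
first marginal the law of `c` is realized by some `(c, Z)`. -/
theorem exists_map_prodMk_eq [IsProbabilityMeasure P] (hP : IsAtomless P) {ι E : Type*}
    [Countable ι] [MeasurableSpace ι] [MeasurableSingletonClass ι]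
    [MeasurableSpace E] [StandardBorelSpace E] {c : Ω → ι} (hc : Measurable c)
    (κ : Kernel ι E) [IsMarkovKernel κ] :
    ∃ Z : Ω → E, Measurable Z ∧ P.map (fun ω => (c ω, Z ω)) = (P.map c) ⊗ₘ κ := by
  -- Conditioning on a cell `c = i` of positive mass leaves an atomless probability space, which
  -- carries a variable of law `κ i`; on null cells any variable will do. Countability of `ι` makes
  -- the glued map measurable and its law a sum over cells.
  have hpiece : ∀ i, ∃ Z : Ω → E, Measurable Z ∧
      ∀ s, MeasurableSet s → P (c ⁻¹' {i} ∩ Z ⁻¹' s) = P (c ⁻¹' {i}) * κ i s := by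
    intro i
    have hi := hc (measurableSet_singleton i)
    by_cases h0 : P (c ⁻¹' {i}) = 0
    · obtain ⟨Z, hZ, -⟩ := hP.exists_map_eq (κ i)
      exact ⟨Z, hZ, fun s _ => by
        rw [measure_mono_null Set.inter_subset_left h0, h0, zero_mul]⟩
    · have := cond_isProbabilityMeasure h0
      obtain ⟨Z, hZ, hZκ⟩ := (hP.cond hi h0).exists_map_eq (κ i)
      refine ⟨Z, hZ, fun s hs => ?_⟩
      rw [← hZκ, Measure.map_apply hZ hs, mul_comm, cond_mul_eq_inter hi]
  choose Z hZ hZκ using hpiece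
  have hm : Measurable fun ω => Z (c ω) ω :=
    (measurable_from_prod_countable_right (f := fun p : ι × Ω => Z p.1 p.2) fun i => hZ i).comp (hc.prodMk measurable_id)
  refine ⟨fun ω => Z (c ω) ω, hm, ?_⟩
  have := Measure.isProbabilityMeasure_map (μ := P) hc.aemeasurable
  have hpair : Measurable fun ω => (c ω, Z (c ω) ω) := hc.prodMk hm
  have hsing : ∀ i s, MeasurableSet s →
      P.map (fun ω => (c ω, Z (c ω) ω)) ({i} ×ˢ s) = ((P.map c) ⊗ₘ κ) ({i} ×ˢ s) := by
    intro i s hs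
    have hi := measurableSet_singleton i
    rw [Measure.map_apply hpair (hi.prod hs), Measure.compProd_apply_prod hi hs,
      lintegral_singleton, Measure.map_apply hc hi, mul_comm, ← hZκ i s hs]
    congr 1
    ext ω
    simp only [Set.mem_preimage, Set.mem_prod, Set.mem_singleton_iff, Set.mem_inter_iff]
    constructor <;> rintro ⟨rfl, h⟩ <;> exact ⟨rfl, h⟩
  refine Measure.ext fun t ht => ?_
  have hcut : t = ⋃ i, {i} ×ˢ (Prod.mk i ⁻¹' t) := by
    ext ⟨i, z⟩
    simp
  have hdisj : Pairwise (Function.onFun Disjoint fun i : ι => ({i} : Set ι) ×ˢ (Prod.mk i ⁻¹' t)) :=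
    fun i j hij => Set.disjoint_left.2 fun p hp hp' => hij (hp.1.symm.trans hp'.1)
  have hmeas : ∀ i : ι, MeasurableSet (({i} : Set ι) ×ˢ (Prod.mk i ⁻¹' t)) := fun i =>
    (measurableSet_singleton i).prod (measurable_prodMk_left ht)
  rw [hcut, measure_iUnion hdisj hmeas, measure_iUnion hdisj hmeas]
  exact tsum_congr fun i => hsing i _ (measurable_prodMk_left ht)

end IsAtomless

/-! ### Discretization and approximate copies -/

/-- A separable metric space splits measurably into countably many cells of small diameter. -/
theorem exists_measurable_nat_dist_le {E : Type*} [PseudoMetricSpace E]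
    [TopologicalSpace.SeparableSpace E] [Nonempty E] [MeasurableSpace E] [OpensMeasurableSpace E]
    {ε : ℝ} (hε : 0 < ε) :
    ∃ (q : E → ℕ) (r : ℕ → E), Measurable q ∧ ∀ x, dist x (r (q x)) ≤ ε := by
  classical
  have hex : ∀ x, ∃ n, dist x (TopologicalSpace.denseSeq E n) ≤ ε := fun x => by
    obtain ⟨n, hn⟩ := (TopologicalSpace.denseRange_denseSeq E).exists_dist_lt x hε
    exact ⟨n, hn.le⟩
  exact ⟨fun x => Nat.find (hex x), TopologicalSpace.denseSeq E,
    measurable_find hex fun n => (isClosed_le (by fun_prop) (by fun_prop)).measurableSet,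
    fun x => Nat.find_spec (hex x)⟩

/-- Used to forget the cell of `G`: a variable sampled given the cells of both `X` and `G`, through
a kernel that sees only the first, has the expected joint law with the first alone. -/
theorem MeasureTheory.Measure.map_compProd_comap {α β γ : Type*} [MeasurableSpace α]
    [MeasurableSpace β] [MeasurableSpace γ] (ν : Measure α) [SFinite ν] (κ : Kernel β γ)
    [IsSFiniteKernel κ] {f : α → β} (hf : Measurable f) :
    (ν ⊗ₘ κ.comap f hf).map (Prod.map f id) = (ν.map f) ⊗ₘ κ := by
  refine Measure.ext fun s hs => ?_
  rw [Measure.map_apply (hf.prodMap measurable_id) hs,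
    Measure.compProd_apply (hf.prodMap measurable_id hs), Measure.compProd_apply hs,
    lintegral_map (Kernel.measurable_kernel_prodMk_left hs) hf]
  rfl

section

variable {Ω Ω' : Type*} [MeasurableSpace Ω] [MeasurableSpace Ω'] {P : Measure Ω}
  {P' : Measure Ω'}

/-- If `X` lies in the same cell as `Z`, jointly with the cell in law, then `X` and `Z` are
close. -/
theorem ae_dist_le_of_identDistrib {E : Type*} [PseudoMetricSpace E] [MeasurableSpace E]
    {q : E → ℕ} {r : ℕ → E} {ε : ℝ} (hq : Measurable q) (hr : ∀ x, dist x (r (q x)) ≤ ε)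
    {X Z : Ω → E} {X' : Ω' → E}
    (h : IdentDistrib (fun ω => (q (X ω), Z ω)) (fun ω => (q (X' ω), X' ω)) P P') :
    ∀ᵐ ω ∂P, dist (Z ω) (X ω) ≤ ε + ε := by
  have hset : MeasurableSet {p : ℕ × E | p.1 = q p.2} :=
    measurableSet_eq_fun measurable_fst (hq.comp measurable_snd)
  -- Lying in the recorded cell is a property of the joint law, and it holds surely for `X'`.
  have hae := h.symm.ae_snd hset (.of_forall fun ω => rfl)
  filter_upwards [hae] with ω hω
  have hω : q (X ω) = q (Z ω) := hω
  refine (dist_triangle_right _ _ (r (q (Z ω)))).trans (add_le_add (hr _) ?_)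
  rw [← hω]
  exact hr _

/-- The tower property: against a function of `c`, `w (Z)` may be replaced by its conditional mean
given `c`. Integrability of `w (Z)` itself makes `w` integrable for almost every `κ i`, so that `φ
i` can be pulled out of the inner integral. -/
theorem integral_inner_of_map_eq_compProd {ι F E : Type*} [Countable ι] [MeasurableSpace ι]
    [MeasurableSingletonClass ι] [MeasurableSpace F]
    [NormedAddCommGroup E] [InnerProductSpace ℝ E] [CompleteSpace E] [SecondCountableTopology E]
    [MeasurableSpace E] [BorelSpace E] [IsFiniteMeasure P] {c : Ω → ι} {Z : Ω → F}
    (hc : Measurable c) (hZ : Measurable Z) {κ : Kernel ι F} [IsSFiniteKernel κ]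
    (h : P.map (fun ω => (c ω, Z ω)) = (P.map c) ⊗ₘ κ) (φ : ι → E) {w : F → E}
    (hw : Measurable w) (hint : Integrable (fun ω => w (Z ω)) P)
    (hint' : Integrable (fun ω => inner ℝ (φ (c ω)) (w (Z ω))) P) :
    ∫ ω, inner ℝ (φ (c ω)) (w (Z ω)) ∂P =
      ∫ ω, inner ℝ (φ (c ω)) (∫ z, w z ∂κ (c ω)) ∂P := by
  have hcZ : Measurable fun ω => (c ω, Z ω) := hc.prodMk hZ
  have hφ : Measurable φ := .of_discrete
  have hm : Measurable fun p : ι × F => inner ℝ (φ p.1) (w p.2) :=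
    (hφ.comp measurable_fst).inner (hw.comp measurable_snd)
  have hI : Integrable (fun p : ι × F => inner ℝ (φ p.1) (w p.2)) ((P.map c) ⊗ₘ κ) := by
    rw [← h, integrable_map_measure hm.aestronglyMeasurable hcZ.aemeasurable]
    exact hint'
  have hm' : Measurable fun p : ι × F => w p.2 := hw.comp measurable_snd
  have hI' : Integrable (fun p : ι × F => w p.2) ((P.map c) ⊗ₘ κ) := by
    rw [← h, integrable_map_measure hm'.aestronglyMeasurable hcZ.aemeasurable]
    exact hint
  have hae := ((Measure.integrable_compProd_iff hI'.aestronglyMeasurable).1 hI').1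
  calc ∫ ω, inner ℝ (φ (c ω)) (w (Z ω)) ∂P
      = ∫ p, inner ℝ (φ p.1) (w p.2) ∂(P.map fun ω => (c ω, Z ω)) :=
        (integral_map hcZ.aemeasurable hm.aestronglyMeasurable).symm
    _ = ∫ i, ∫ z, inner ℝ (φ i) (w z) ∂κ i ∂(P.map c) := by
        rw [h, Measure.integral_compProd hI]
    _ = ∫ i, inner ℝ (φ i) (∫ z, w z ∂κ i) ∂(P.map c) := by
        refine integral_congr_ae ?_
        filter_upwards [hae] with i hi
        exact integral_inner hi (φ i)
    _ = _ := integral_map hc.aemeasurable Measurable.of_discrete.aestronglyMeasurable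

variable [IsProbabilityMeasure P] [IsProbabilityMeasure P']

/-- On an atomless space, if `X` has the law of `X'`, then any pair `(X', Y')` has a copy
`(X₁, Y₁)` with `X₁` uniformly close to `X`. -/
theorem IsAtomless.exists_identDistrib_dist_le (hP : IsAtomless P) {E E' : Type*}
    [MetricSpace E] [CompleteSpace E] [SecondCountableTopology E] [MeasurableSpace E]
    [BorelSpace E] [MeasurableSpace E'] [StandardBorelSpace E'] {X : Ω → E} {X' : Ω' → E}
    {Y' : Ω' → E'} (hX : Measurable X) (hX' : Measurable X') (hY' : Measurable Y')
    (h : IdentDistrib X X' P P') {ε : ℝ} (hε : 0 < ε) :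
    ∃ (X₁ : Ω → E) (Y₁ : Ω → E'), Measurable X₁ ∧ Measurable Y₁ ∧
      IdentDistrib (fun ω => (X₁ ω, Y₁ ω)) (fun ω => (X' ω, Y' ω)) P P' ∧
      ∀ᵐ ω ∂P, dist (X₁ ω) (X ω) ≤ ε := by
  obtain ⟨ω'⟩ : Nonempty Ω' := nonempty_of_isProbabilityMeasure P'
  have : Nonempty E := ⟨X' ω'⟩
  have : Nonempty E' := ⟨Y' ω'⟩
  obtain ⟨q, r, hq, hr⟩ := exists_measurable_nat_dist_le (E := E) (half_pos hε)
  have hXY' : Measurable fun ω => (X' ω, Y' ω) := hX'.prodMk hY'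
  -- Sample `Z` given the cell of `X` from the conditional law of `(X', Y')` given the cell of `X'`.
  -- The two cells have the same law, so `Z` is a copy of `(X', Y')` whose first coordinate shares
  -- the cell of `X`.
  obtain ⟨Z, hZ, hZκ⟩ := hP.exists_map_prodMk_eq (hq.comp hX)
    (condDistrib (fun ω => (X' ω, Y' ω)) (q ∘ X') P')
  rw [(h.comp hq).map_eq, compProd_map_condDistrib hXY'.aemeasurable] at hZκ
  have hid : IdentDistrib (fun ω => ((q ∘ X) ω, Z ω))
      (fun ω => ((q ∘ X') ω, (X' ω, Y' ω))) P P' :=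
    ⟨((hq.comp hX).prodMk hZ).aemeasurable, ((hq.comp hX').prodMk hXY').aemeasurable, hZκ⟩
  refine ⟨fun ω => (Z ω).1, fun ω => (Z ω).2, hZ.fst, hZ.snd, hid.comp measurable_snd, ?_⟩
  have := ae_dist_le_of_identDistrib hq hr (Z := fun ω => (Z ω).1)
    (hid.comp (measurable_fst.prodMk (measurable_fst.comp measurable_snd)))
  simpa using this

end

/-! ### Resampling in `L²` -/

section

variable {Ω : Type*} [MeasurableSpace Ω] {P : Measure Ω} [IsProbabilityMeasure P]
  {E : Type*} [NormedAddCommGroup E]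

theorem norm_sub_le_of_ae_dist_le {X Y : Lp E 2 P} {ε : ℝ} (hε : 0 ≤ ε)
    (h : ∀ᵐ ω ∂P, dist (X ω) (Y ω) ≤ ε) : ‖X - Y‖ ≤ ε := by
  have := Lp.norm_le_of_ae_bound (f := X - Y) hε (by
    filter_upwards [h, Lp.coeFn_sub X Y] with ω hω hsub
    rwa [hsub, Pi.sub_apply, ← dist_eq_norm])
  simpa [measureUnivNNReal] using this

variable [InnerProductSpace ℝ E] [CompleteSpace E] [SecondCountableTopology E]
  [MeasurableSpace E] [BorelSpace E]

/-- On an atomless space, `(X, G)` has a copy `(X₁, Y₁)` with `X₁` close to `X` and `Y₁` nearly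
orthogonal to the part of `G` that is orthogonal to the functions of `X`. -/
theorem IsAtomless.exists_resample (hP : IsAtomless P) (X G : Lp E 2 P) {ε : ℝ} (hε : 0 < ε) :
    ∃ X₁ Y₁ : Lp E 2 P,
      IdentDistrib (fun ω => (X₁ ω, Y₁ ω)) (fun ω => (X ω, G ω)) P P ∧ ‖X₁ - X‖ ≤ ε ∧
      ∃ h : E → E, Measurable h ∧ ∃ H : Lp E 2 P, (H =ᵐ[P] fun ω => h (X ω)) ∧
        inner ℝ G H = ‖H‖ ^ 2 ∧ inner ℝ G Y₁ ≤ inner ℝ G H + ε * (‖Y₁‖ + ‖H‖) := by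
  have hX : Measurable X := (Lp.stronglyMeasurable X).measurable
  have hG : Measurable G := (Lp.stronglyMeasurable G).measurable
  have hXG : Measurable fun ω => (X ω, G ω) := hX.prodMk hG
  obtain ⟨q, r, hq, hr⟩ := exists_measurable_nat_dist_le (E := E) (half_pos hε)
  have ha : Measurable (q ∘ X) := hq.comp hX
  have hb : Measurable (q ∘ G) := hq.comp hG
  have hab : Measurable fun ω => (q (X ω), q (G ω)) := ha.prodMk hb
  let κ := condDistrib (fun ω => (X ω, G ω)) (q ∘ X) P
  have hκ : (P.map (q ∘ X)) ⊗ₘ κ = P.map fun ω => ((q ∘ X) ω, (X ω, G ω)) :=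
    compProd_map_condDistrib hXG.aemeasurable
  -- The kernel ignores the second label: given the cell of `X`, the copy `Z` of `(X, G)` is
  -- independent of the cell of `G`.
  obtain ⟨Z, hZ, hZκ⟩ := hP.exists_map_prodMk_eq hab (κ.comap Prod.fst measurable_fst)
  have hZa : P.map (fun ω => ((q ∘ X) ω, Z ω)) = (P.map (q ∘ X)) ⊗ₘ κ := by
    have := Measure.map_compProd_comap (P.map fun ω => (q (X ω), q (G ω))) κ measurable_fst
    rw [← hZκ, Measure.map_map (by fun_prop) (hab.prodMk hZ),
      Measure.map_map measurable_fst hab] at this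
    exact this
  have hid : IdentDistrib (fun ω => ((q ∘ X) ω, Z ω))
      (fun ω => ((q ∘ X) ω, (X ω, G ω))) P P :=
    ⟨(ha.prodMk hZ).aemeasurable, (ha.prodMk hXG).aemeasurable, hZa.trans hκ⟩
  have hidXG : IdentDistrib Z (fun ω => (X ω, G ω)) P P := hid.comp measurable_snd
  have hX₁ : MemLp (fun ω => (Z ω).1) 2 P :=
    (hidXG.comp measurable_fst).symm.memLp_snd (Lp.memLp X)
  have hY₁ : MemLp (fun ω => (Z ω).2) 2 P :=
    (hidXG.comp measurable_snd).symm.memLp_snd (Lp.memLp G)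
  let h₀ : ℕ → E := fun i => ∫ z, z.2 ∂κ i
  have hGint : Integrable G P := (Lp.memLp G).integrable (by norm_num)
  -- `h₀ ∘ q ∘ X` is the conditional expectation of `G` given the cell of `X`, and conditional
  -- expectation contracts the `L²` norm.
  have hH : MemLp (fun ω => h₀ (q (X ω))) 2 P := by
    have h1 := condExp_ae_eq_integral_condDistrib (μ := P) ha hXG.aemeasurable
      (f := fun z : E × E => z.2) measurable_snd.stronglyMeasurable hGint
    refine MemLp.ae_eq h1 ⟨integrable_condExp.aestronglyMeasurable, ?_⟩
    exact (eLpNorm_condExp_le_eLpNorm _ (by norm_num)).trans_lt (Lp.memLp G).2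
  -- `G` rounded to the centre of its cell: within `ε / 2` of `G`, and a function of the label from
  -- which `Z` is conditionally independent.
  have hGδ : MemLp (fun ω => r (q (G ω))) 2 P := by
    have h1 : MemLp (fun ω => r (q (G ω)) - G ω) 2 P := by
      refine MemLp.of_bound
        (((measurable_from_nat (f := r)).comp hb).sub hG).aestronglyMeasurable (ε / 2)
        (.of_forall fun ω => ?_)
      rw [← dist_eq_norm, dist_comm]
      exact hr _
    exact (h1.add (Lp.memLp G)).ae_eq (.of_forall fun ω => sub_add_cancel _ _)
  let X₁ := hX₁.toLp
  let Y₁ := hY₁.toLp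
  let H := hH.toLp
  let Gδ := hGδ.toLp
  have hGGδ : ‖G - Gδ‖ ≤ ε / 2 := norm_sub_le_of_ae_dist_le (half_pos hε).le (by
    filter_upwards [hGδ.coeFn_toLp] with ω hω
    rw [hω]
    exact hr _)
  have hinner : ∀ {A B : Lp E 2 P} {A' B' : Ω → E}, A =ᵐ[P] A' → B =ᵐ[P] B' →
      inner ℝ A B = ∫ ω, inner ℝ (A' ω) (B' ω) ∂P := fun hA hB => by
    rw [L2.inner_def]
    exact integral_congr_ae (by filter_upwards [hA, hB] with ω h1 h2; rw [h1, h2])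
  have hinner_int : ∀ {A B : Lp E 2 P} {A' B' : Ω → E}, A =ᵐ[P] A' → B =ᵐ[P] B' →
      Integrable (fun ω => inner ℝ (A' ω) (B' ω)) P := fun {A B _ _} hA hB =>
    (L2.integrable_inner (𝕜 := ℝ) A B).congr
      (by filter_upwards [hA, hB] with ω h1 h2; rw [h1, h2])
  have hGH : inner ℝ G H = ‖H‖ ^ 2 := by
    rw [← real_inner_self_eq_norm_sq, real_inner_comm, hinner hH.coeFn_toLp .rfl,
      hinner hH.coeFn_toLp hH.coeFn_toLp]
    exact integral_inner_of_map_eq_compProd ha hXG hκ.symm h₀ measurable_snd hGint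
      (hinner_int hH.coeFn_toLp .rfl)
  have hGδY : inner ℝ Gδ Y₁ = inner ℝ Gδ H := by
    rw [hinner hGδ.coeFn_toLp hY₁.coeFn_toLp, hinner hGδ.coeFn_toLp hH.coeFn_toLp]
    exact integral_inner_of_map_eq_compProd hab hZ hZκ (fun i => r i.2) measurable_snd
      (hY₁.integrable (by norm_num)) (hinner_int hGδ.coeFn_toLp hY₁.coeFn_toLp)
  refine ⟨X₁, Y₁, ?_, ?_, fun x => h₀ (q x), (measurable_from_nat (f := h₀)).comp hq, H,
    hH.coeFn_toLp, hGH, ?_⟩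
  · refine IdentDistrib.trans (IdentDistrib.of_ae_eq hZ.aemeasurable ?_).symm hidXG
    filter_upwards [hX₁.coeFn_toLp, hY₁.coeFn_toLp] with ω h1 h2
    exact Prod.ext h1.symm h2.symm
  · refine norm_sub_le_of_ae_dist_le hε.le ?_
    have := ae_dist_le_of_identDistrib hq hr (Z := fun ω => (Z ω).1)
      (hid.comp (measurable_fst.prodMk (measurable_fst.comp measurable_snd)))
    filter_upwards [this, hX₁.coeFn_toLp] with ω h1 h2
    rw [h2]
    simpa using h1
  -- Pass from `G` to `Gδ` against `Y₁` and back against `H`, at a cost of `ε / 2` times the norm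
  -- each time.
  · have e1 := real_inner_le_norm (G - Gδ) Y₁
    have e2 := real_inner_le_norm (Gδ - G) H
    rw [norm_sub_rev] at e2
    rw [inner_sub_left] at e1 e2
    have e3 := mul_le_mul_of_nonneg_right hGGδ (norm_nonneg Y₁)
    have e4 := mul_le_mul_of_nonneg_right hGGδ (norm_nonneg H)
    have e5 := mul_nonneg hε.le (norm_nonneg Y₁)
    have e6 := mul_nonneg hε.le (norm_nonneg H)
    nlinarith

end

/-! ### The gradient is a function of `X` -/

theorem HasGradientAt.exists_abs_sub_le {V : Type*} [NormedAddCommGroup V] [InnerProductSpace ℝ V]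
    [CompleteSpace V] {F : V → ℝ} {G X : V} (h : HasGradientAt F G X) {η : ℝ} (hη : 0 < η) :
    ∃ ρ > 0, ∀ W, ‖W‖ < ρ → |F (X + W) - F X - inner ℝ G W| ≤ η * ‖W‖ := by
  have h1 := hasFDerivAt_iff_isLittleO_nhds_zero.1 h.hasFDerivAt
  obtain ⟨ρ, hρ, h2⟩ := Metric.eventually_nhds_iff.1 (Asymptotics.isLittleO_iff.1 h1 hη)
  exact ⟨ρ, hρ, fun W hW => by simpa using h2 (by simpa using hW)⟩

theorem hasGradientAt_of_abs_sub_le {V : Type*} [NormedAddCommGroup V] [InnerProductSpace ℝ V]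
    [CompleteSpace V] {F : V → ℝ} {G X : V}
    (h : ∀ η > 0, ∃ ρ > 0, ∀ W, ‖W‖ < ρ → |F (X + W) - F X - inner ℝ G W| ≤ η * ‖W‖) :
    HasGradientAt F G X := by
  refine hasGradientAt_iff_hasFDerivAt.2 (hasFDerivAt_iff_isLittleO_nhds_zero.2 ?_)
  refine Asymptotics.isLittleO_iff.2 fun η hη => ?_
  obtain ⟨ρ, hρ, h1⟩ := h η hη
  exact Metric.eventually_nhds_iff.2 ⟨ρ, hρ, fun W hW => by
    simpa using h1 W (by simpa using hW)⟩

section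

variable {Ω : Type*} [MeasurableSpace Ω] {P : Measure Ω} {d : ℕ}
  {F : Lp (EuclideanSpace ℝ (Fin d)) 2 P → ℝ}

theorem LawInvariant.add_smul_eq (hF : LawInvariant F)
    {X Y X' Y' : Lp (EuclideanSpace ℝ (Fin d)) 2 P}
    (h : IdentDistrib (fun ω => (X ω, Y ω)) (fun ω => (X' ω, Y' ω)) P P) (t : ℝ) :
    F (X + t • Y) = F (X' + t • Y') := by
  have hco : ∀ A B : Lp (EuclideanSpace ℝ (Fin d)) 2 P,
      (fun ω => A ω + t • B ω) =ᵐ[P] (A + t • B : Lp (EuclideanSpace ℝ (Fin d)) 2 P) := by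
    intro A B
    filter_upwards [Lp.coeFn_add A (t • B), Lp.coeFn_smul t B] with ω h1 h2
    rw [h1, Pi.add_apply, h2, Pi.smul_apply]
  have h1 := h.comp (u := fun p : EuclideanSpace ℝ (Fin d) × EuclideanSpace ℝ (Fin d) =>
    p.1 + t • p.2) (by fun_prop)
  exact hF _ _ (((IdentDistrib.of_ae_eq h1.aemeasurable_fst (hco X Y)).symm.trans h1).trans
    (IdentDistrib.of_ae_eq h1.aemeasurable_snd (hco X' Y')))

theorem norm_eq_of_identDistrib {E : Type*} [NormedAddCommGroup E] [MeasurableSpace E]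
    [OpensMeasurableSpace E] {A B : Lp E 2 P} (h : IdentDistrib A B P P) : ‖A‖ = ‖B‖ := by
  rw [Lp.norm_def, Lp.norm_def, h.eLpNorm_eq]

variable [IsProbabilityMeasure P]

/-- The gradient of a law invariant function at `X` is approximated by functions of `X`. -/
theorem LawInvariant.exists_norm_sub_sq_le (hF : LawInvariant F) (hP : IsAtomless P)
    {X G : Lp (EuclideanSpace ℝ (Fin d)) 2 P} (hG : HasGradientAt F G X) {δ : ℝ} (hδ : 0 < δ) :
    ∃ h : EuclideanSpace ℝ (Fin d) → EuclideanSpace ℝ (Fin d), Measurable h ∧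
      ∃ H : Lp (EuclideanSpace ℝ (Fin d)) 2 P, (H =ᵐ[P] fun ω => h (X ω)) ∧ ‖G - H‖ ^ 2 ≤ δ := by
  set N := ‖G‖ with hN
  have hN0 : 0 ≤ N := norm_nonneg G
  -- The final error is `5 * η * N + η ^ 2`: remainders `η * N` and `η * (N + η)` of the two
  -- expansions, `η * N` from `X₁ - X`, and `2 * η * N` from the resampling.
  obtain ⟨η, hη, hη1, hηδ⟩ : ∃ η > 0, η ≤ 1 ∧ η * (5 * N + 1) ≤ δ := by
    refine ⟨min 1 (δ / (5 * N + 1)), by positivity, min_le_left _ _, ?_⟩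
    rw [← le_div_iff₀ (by positivity)]
    exact min_le_right _ _
  obtain ⟨ρ, hρ, hexp⟩ := hG.exists_abs_sub_le hη
  -- Keeps both increments `t • G` and `X₁ - X + t • Y₁` inside the ball of radius `ρ`.
  obtain ⟨t, ht, ht1, htρ⟩ : ∃ t > 0, t ≤ 1 ∧ t * (N + 1) < ρ := by
    refine ⟨min 1 (ρ / 2 / (N + 1)), by positivity, min_le_left _ _, ?_⟩
    refine lt_of_le_of_lt ?_ (half_lt_self hρ)
    rw [← le_div_iff₀ (by positivity)]
    exact min_le_right _ _
  -- Precision `η * t` keeps the displacement `X₁ - X` negligible after division by `t`.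
  obtain ⟨X₁, Y₁, hid, hX₁, h, hh, H, hH, hGH, hGY⟩ := hP.exists_resample X G (mul_pos hη ht)
  refine ⟨h, hh, H, hH, ?_⟩
  have hY₁ : ‖Y₁‖ = N := norm_eq_of_identDistrib (hid.comp measurable_snd)
  have hHN : ‖H‖ ≤ N := by
    have h1 := real_inner_le_norm G H
    rw [hGH] at h1
    by_contra! hlt
    nlinarith [norm_nonneg H]
  have hnt : ‖t • G‖ = t * N := by rw [norm_smul, Real.norm_of_nonneg ht.le]
  have hnt' : ‖t • Y₁‖ = t * N := by rw [norm_smul, Real.norm_of_nonneg ht.le, hY₁]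
  have hW : ‖X₁ - X + t • Y₁‖ ≤ t * (N + η) :=
    (norm_add_le _ _).trans (by rw [hnt']; linarith)
  have e1 := hexp (t • G) (by rw [hnt]; nlinarith)
  have e2 := hexp (X₁ - X + t • Y₁) (by nlinarith)
  -- Law invariance turns `e2` into a second expansion of the same number `F (X + t • G)`.
  rw [← add_assoc, add_sub_cancel, hF.add_smul_eq hid, inner_add_right, inner_smul_right] at e2
  rw [hnt, inner_smul_right, real_inner_self_eq_norm_sq, ← hN] at e1
  have e3 := real_inner_le_norm G (X₁ - X)
  have e4 : N * ‖X₁ - X‖ ≤ N * (η * t) := by gcongr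
  have e5 : η * ‖X₁ - X + t • Y₁‖ ≤ η * (t * (N + η)) := by gcongr
  have e6 : t * N ^ 2 ≤ t * (inner ℝ G Y₁ + 3 * η * N + η ^ 2) := by
    linarith [(abs_le.1 e1).1, (abs_le.1 e2).2]
  have e7 := le_of_mul_le_mul_left e6 ht
  have e8 : η * t * (‖Y₁‖ + ‖H‖) ≤ η * 1 * (N + N) := by rw [hY₁]; gcongr
  rw [norm_sub_sq_real, hGH, ← hN]
  nlinarith

/-- The gradient of a law invariant function at `X` is a function of `X`. -/
theorem LawInvariant.exists_gradient_eq_comp (hF : LawInvariant F) (hP : IsAtomless P)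
    {X G : Lp (EuclideanSpace ℝ (Fin d)) 2 P} (hG : HasGradientAt F G X) :
    ∃ g : EuclideanSpace ℝ (Fin d) → EuclideanSpace ℝ (Fin d), Measurable g ∧
      MemLp g 2 (P.map X) ∧ G =ᵐ[P] fun ω => g (X ω) := by
  have hX : MeasurePreserving X P (P.map X) :=
    (Lp.stronglyMeasurable X).measurable.measurePreserving P
  -- Composition with `X` embeds `L²` of the law isometrically; completeness makes its range closed,
  -- so approximation by functions of `X` suffices.
  have hclosed := (Lp.isometry_compMeasurePreserving (E := EuclideanSpace ℝ (Fin d)) (p := 2)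
    hX).isClosedEmbedding.isClosed_range
  have hmem : G ∈ Set.range
      (Lp.compMeasurePreserving (E := EuclideanSpace ℝ (Fin d)) (p := 2) X hX) := by
    rw [← hclosed.closure_eq]
    refine Metric.mem_closure_iff.2 fun ε hε => ?_
    obtain ⟨h, hh, H, hH, hGH⟩ := hF.exists_norm_sub_sq_le hP hG (δ := (ε / 2) ^ 2) (by positivity)
    have hmem : MemLp h 2 (P.map X) :=
      (memLp_map_measure_iff hh.aestronglyMeasurable hX.aemeasurable).2 ((Lp.memLp H).ae_eq hH)
    refine ⟨H, ⟨hmem.toLp, ?_⟩, ?_⟩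
    · rw [Lp.toLp_compMeasurePreserving]
      exact Lp.ext ((MemLp.coeFn_toLp _).trans hH.symm)
    · rw [dist_eq_norm]
      have := abs_le_of_sq_le_sq hGH (by positivity)
      rw [abs_of_nonneg (norm_nonneg _)] at this
      linarith
  obtain ⟨g, hg⟩ := hmem
  refine ⟨g, (Lp.stronglyMeasurable g).measurable, Lp.memLp g, ?_⟩
  rw [← hg]
  exact Lp.coeFn_compMeasurePreserving g hX

/-! ### Transfer to variables with the same law -/

/-- If `g` is square integrable for the law of `X`, then `g ∘ X₁` is close to `g ∘ X` for all `X₁`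
uniformly close to `X` and having the same law. -/
theorem exists_eLpNorm_comp_sub_comp_le {E E' : Type*} [MetricSpace E]
    [ProperSpace E] [MeasurableSpace E] [BorelSpace E]
    [NormedAddCommGroup E'] [NormedSpace ℝ E'] {X : Ω → E} (hX : AEMeasurable X P)
    {g : E → E'} (hg : MemLp g 2 (P.map X)) {η : ℝ} (hη : 0 < η) :
    ∃ ε > 0, ∀ X₁ : Ω → E, IdentDistrib X₁ X P P → (∀ᵐ ω ∂P, dist (X₁ ω) (X ω) ≤ ε) →
      eLpNorm (fun ω => g (X₁ ω) - g (X ω)) 2 P ≤ ENNReal.ofReal η := by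
  -- The error of a uniformly continuous approximation `φ` depends only on the law, hence is the
  -- same along `X₁` and `X`.
  obtain ⟨φ, hφc, hφg, hφ, hφm⟩ := hg.exists_hasCompactSupport_eLpNorm_sub_le (by norm_num)
    (ε := ENNReal.ofReal (η / 3)) (by simpa using hη)
  have huc := hφc.uniformContinuous_of_continuous hφ
  obtain ⟨ε, hε, hφε⟩ := Metric.uniformContinuous_iff.1 huc (η / 3) (by positivity)
  refine ⟨ε / 2, by positivity, fun X₁ hid hdist => ?_⟩
  have hsub : AEStronglyMeasurable (g - φ) (P.map X) := (hg.sub hφm).aestronglyMeasurable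
  have e1 : eLpNorm ((g - φ) ∘ X) 2 P ≤ ENNReal.ofReal (η / 3) := by
    rwa [← eLpNorm_map_measure hsub hX]
  have hsub₁ : AEStronglyMeasurable (g - φ) (P.map X₁) := by rwa [hid.map_eq]
  have e2 : eLpNorm ((g - φ) ∘ X₁) 2 P ≤ ENNReal.ofReal (η / 3) := by
    rwa [← eLpNorm_map_measure hsub₁ hid.aemeasurable_fst, hid.map_eq]
  have e3 : eLpNorm (fun ω => φ (X₁ ω) - φ (X ω)) 2 P ≤ ENNReal.ofReal (η / 3) := by
    have := eLpNorm_le_of_ae_bound (p := 2) (μ := P) (f := fun ω => φ (X₁ ω) - φ (X ω))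
      (C := η / 3) (by
        filter_upwards [hdist] with ω hω
        rw [← dist_eq_norm]
        exact (hφε (by linarith)).le)
    simpa using this
  have hm := hsub.comp_aemeasurable hX
  have hm₁ := hsub₁.comp_aemeasurable hid.aemeasurable_fst
  have hmφ := (hφ.comp_aestronglyMeasurable hid.aemeasurable_fst.aestronglyMeasurable).sub
    (hφ.comp_aestronglyMeasurable hX.aestronglyMeasurable)
  calc eLpNorm (fun ω => g (X₁ ω) - g (X ω)) 2 P
      = eLpNorm ((g - φ) ∘ X₁ + (fun ω => φ (X₁ ω) - φ (X ω)) - (g - φ) ∘ X) 2 P := by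
        congr 1
        ext ω
        simp
    _ ≤ eLpNorm ((g - φ) ∘ X₁ + fun ω => φ (X₁ ω) - φ (X ω)) 2 P + eLpNorm ((g - φ) ∘ X) 2 P :=
        eLpNorm_sub_le (hm₁.add hmφ) hm (by norm_num)
    _ ≤ eLpNorm ((g - φ) ∘ X₁) 2 P + eLpNorm (fun ω => φ (X₁ ω) - φ (X ω)) 2 P +
          eLpNorm ((g - φ) ∘ X) 2 P := by
        gcongr
        exact eLpNorm_add_le hm₁ hmφ (by norm_num)
    _ ≤ ENNReal.ofReal (η / 3) + ENNReal.ofReal (η / 3) + ENNReal.ofReal (η / 3) := by gcongr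
    _ = ENNReal.ofReal η := by
        rw [← ENNReal.ofReal_add (by positivity) (by positivity),
          ← ENNReal.ofReal_add (by positivity) (by positivity)]
        congr 1
        ring

/-- A law invariant function with gradient `g ∘ X` at `X` has gradient `g ∘ X'` at every `X'` with
the law of `X`. -/
theorem LawInvariant.hasGradientAt_of_identDistrib (hF : LawInvariant F) (hP : IsAtomless P)
    {X G X' G' : Lp (EuclideanSpace ℝ (Fin d)) 2 P} (hG : HasGradientAt F G X)
    {g : EuclideanSpace ℝ (Fin d) → EuclideanSpace ℝ (Fin d)} (hg : Measurable g)
    (hgX : G =ᵐ[P] fun ω => g (X ω)) (hgX' : G' =ᵐ[P] fun ω => g (X' ω))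
    (hid : IdentDistrib X X' P P) : HasGradientAt F G' X' := by
  have hX : Measurable X := (Lp.stronglyMeasurable X).measurable
  have hX' : Measurable X' := (Lp.stronglyMeasurable X').measurable
  have hgm : MemLp g 2 (P.map X) :=
    (memLp_map_measure_iff hg.aestronglyMeasurable hX.aemeasurable).2 ((Lp.memLp G).ae_eq hgX)
  refine hasGradientAt_of_abs_sub_le fun η' hη' => ?_
  -- Budget: `2 * η` for the remainder, since the increment has norm at most `2 * ‖Y'‖`, and `η`
  -- each for `⟪G, X₁ - X⟫` and `⟪G₁ - G, Y₁⟫`.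
  obtain ⟨η, hη, rfl⟩ : ∃ η > 0, η' = 4 * η := ⟨η' / 4, by positivity, by ring⟩
  obtain ⟨ρ, hρ, hexp⟩ := hG.exists_abs_sub_le hη
  obtain ⟨ε₀, hε₀, hclose⟩ := exists_eLpNorm_comp_sub_comp_le hX.aemeasurable hgm hη
  obtain ⟨s, hs, hs1, hsη⟩ : ∃ s > 0, s ≤ 1 ∧ s * (‖G‖ + 1) ≤ η := by
    refine ⟨min 1 (η / (‖G‖ + 1)), by positivity, min_le_left _ _, ?_⟩
    rw [← le_div_iff₀ (by positivity)]
    exact min_le_right _ _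
  refine ⟨ρ / 2, by positivity, fun Y' hY'ρ => ?_⟩
  rcases eq_or_ne Y' 0 with rfl | hY'0
  · simp
  have hY'pos : 0 < ‖Y'‖ := norm_pos_iff.2 hY'0
  -- The bound `ε₀` controls `g (X₁) - g (X)`; the bound `s * ‖Y'‖` makes `X₁ - X` negligible
  -- relative to `Y'`, and is positive because `Y' ≠ 0`.
  obtain ⟨x, y, hx, hy, hxy, hdist⟩ := hP.exists_identDistrib_dist_le hX hX'
    (Lp.stronglyMeasurable Y').measurable hid
    (lt_min hε₀ (mul_pos hs hY'pos) : 0 < min ε₀ (s * ‖Y'‖))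
  have hxX' : IdentDistrib x X' P P := hxy.comp measurable_fst
  have hyY' : IdentDistrib y Y' P P := hxy.comp measurable_snd
  have hxm : MemLp x 2 P := hxX'.symm.memLp_snd (Lp.memLp X')
  have hym : MemLp y 2 P := hyY'.symm.memLp_snd (Lp.memLp Y')
  have hgxm : MemLp (fun ω => g (x ω)) 2 P :=
    (hxX'.comp hg).symm.memLp_snd ((Lp.memLp G').ae_eq hgX')
  let X₁ := hxm.toLp
  let Y₁ := hym.toLp
  let G₁ := hgxm.toLp
  have hidLp : IdentDistrib (fun ω => (X₁ ω, Y₁ ω)) (fun ω => (X' ω, Y' ω)) P P := by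
    refine (IdentDistrib.of_ae_eq (hx.prodMk hy).aemeasurable ?_).symm.trans hxy
    filter_upwards [hxm.coeFn_toLp, hym.coeFn_toLp] with ω h1 h2
    exact Prod.ext h1.symm h2.symm
  have hY₁ : ‖Y₁‖ = ‖Y'‖ := norm_eq_of_identDistrib (hidLp.comp measurable_snd)
  have hX₁ : ‖X₁ - X‖ ≤ s * ‖Y'‖ := by
    refine norm_sub_le_of_ae_dist_le (by positivity) ?_
    filter_upwards [hdist, hxm.coeFn_toLp] with ω h1 h2
    rw [h2]
    exact h1.trans (min_le_right _ _)
  have hG₁ : ‖G₁ - G‖ ≤ η := by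
    have h1 := hclose x (hxX'.trans hid.symm) (by
      filter_upwards [hdist] with ω h1 using h1.trans (min_le_left _ _))
    rw [Lp.norm_def]
    refine ENNReal.toReal_le_of_le_ofReal hη.le ((eLpNorm_congr_ae ?_).trans_le h1)
    filter_upwards [Lp.coeFn_sub G₁ G, hgxm.coeFn_toLp, hgX] with ω h1 h2 h3
    rw [h1, Pi.sub_apply, h2, h3]
  -- Both sides are the same functional of the joint laws of `(X', Y')` and of its copy.
  have hinner : inner ℝ G' Y' = inner ℝ G₁ Y₁ := by
    have h1 := (hxy.comp (u := fun p : EuclideanSpace ℝ (Fin d) × EuclideanSpace ℝ (Fin d) =>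
      (inner ℝ (g p.1) p.2 : ℝ)) ((hg.comp measurable_fst).inner measurable_snd)).integral_eq
    rw [L2.inner_def, L2.inner_def]
    refine Eq.trans (integral_congr_ae ?_) (h1.symm.trans (integral_congr_ae ?_))
    · filter_upwards [hgX'] with ω h1
      simp [h1]
    · filter_upwards [hgxm.coeFn_toLp, hym.coeFn_toLp] with ω h1 h2
      simp [G₁, Y₁, h1, h2]
  have hsum : F (X' + Y') = F (X₁ + Y₁) := by
    simpa using (hF.add_smul_eq hidLp 1).symm
  have hW : ‖X₁ - X + Y₁‖ ≤ 2 * ‖Y'‖ :=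
    (norm_add_le _ _).trans (by rw [hY₁]; nlinarith)
  have e1 := hexp (X₁ - X + Y₁) (by linarith)
  rw [← add_assoc, add_sub_cancel, inner_add_right, ← hsum, hF X X' hid] at e1
  have e2 := abs_real_inner_le_norm G (X₁ - X)
  have e3 := abs_real_inner_le_norm (G₁ - G) Y₁
  rw [inner_sub_left, hY₁] at e3
  have e4 : ‖G₁ - G‖ * ‖Y'‖ ≤ η * ‖Y'‖ := by gcongr
  have e5 : ‖G‖ * ‖X₁ - X‖ ≤ η * ‖Y'‖ := by
    calc ‖G‖ * ‖X₁ - X‖ ≤ (‖G‖ + 1) * (s * ‖Y'‖) := by gcongr; linarith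
      _ = s * (‖G‖ + 1) * ‖Y'‖ := by ring
      _ ≤ _ := by gcongr
  have e6 : η * ‖X₁ - X + Y₁‖ ≤ η * (2 * ‖Y'‖) := by gcongr
  rw [hinner]
  obtain ⟨a1, b1⟩ := abs_le.1 e1
  obtain ⟨a2, b2⟩ := abs_le.1 e2
  obtain ⟨a3, b3⟩ := abs_le.1 e3
  refine abs_le.2 ⟨by linarith, by linarith⟩

end

theorem lemma4 {Ω : Type*} [MeasurableSpace Ω] (P : Measure Ω) [IsProbabilityMeasure P]
    (hP : IsAtomless P) (d : ℕ)
    (F : Lp (EuclideanSpace ℝ (Fin d)) 2 P → ℝ) (hF : LawInvariant F)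
    (μ : Measure (EuclideanSpace ℝ (Fin d)))
    (X : Lp (EuclideanSpace ℝ (Fin d)) 2 P) (hX : HasLaw X μ P)
    (hdiff : DifferentiableAt ℝ F X) :
    ∃ g : EuclideanSpace ℝ (Fin d) → EuclideanSpace ℝ (Fin d),
      Measurable g ∧ MemLp g 2 μ ∧
      ((∇ F X : Lp (EuclideanSpace ℝ (Fin d)) 2 P) =ᵐ[P] fun ω => g (X ω)) ∧
      ∀ X' : Lp (EuclideanSpace ℝ (Fin d)) 2 P, HasLaw X' μ P →
        DifferentiableAt ℝ F X' ∧ ((∇ F X' : Lp (EuclideanSpace ℝ (Fin d)) 2 P) =ᵐ[P] fun ω => g (X' ω)) := by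
  obtain ⟨g, hg, hgm, hgX⟩ := hF.exists_gradient_eq_comp hP hdiff.hasGradientAt
  rw [hX.map_eq] at hgm
  refine ⟨g, hg, hgm, hgX, fun X' hX' => ?_⟩
  have hgX' : MemLp (fun ω => g (X' ω)) 2 P := by
    rw [← hX'.map_eq] at hgm
    exact (memLp_map_measure_iff hg.aestronglyMeasurable hX'.aemeasurable).1 hgm
  have hgrad := hF.hasGradientAt_of_identDistrib hP hdiff.hasGradientAt hg hgX
    hgX'.coeFn_toLp (hX.identDistrib hX')
  refine ⟨hgrad.differentiableAt, ?_⟩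
  rw [hgrad.gradient]
  exact hgX'.coeFn_toLp
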